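/- Let $\omega^{<\omega}$ be the set of finite sequences of natural numbers. A tree is a set $T\subseteq\omega^{<\omega}$ closed under initial segments; $[T]=\{x\in\omega^\omega : x{\upharpoonright}n\in T \text{ for all } n\}$ is its set of branches, and for $t\in T$ let $\mathrm{succ}_T(t)=\{n\in\omega : t^\frown n\in T\}$. The stem of $T$, if it exists, is the longest node of $T$ that is comparable (under end-extension) with all nodes of $T$. Laver forcing $\mathbb L$ is the set of trees $T$ that have a stem and such that $\mathrm{succ}_T(t)$ is infinite for every $t\in T$ extending (or equal to) the stem. Miller forcing $\mathbb M$ is the set of nonempty trees $T$ such that every $t\in T$ has an extension $s\supseteq t$ in $T$ with $\mathrm{succ}_T(s)$ infinite. For $\mathbb T\in\{\mathbb L,\mathbb M\}$ the associated tree ideal $t^0$ consists of all $X\subseteq\omega^\omega$ such that for every $T\in\mathbb T$ there is $S\in\mathbb T$ with $S\subseteq T$ and $X\cap[S]=\emptyset$; the Laver ideal $\ell^0$ and the Miller ideal $m^0$ are the tree ideals of $\mathbb L$ and $\mathbb M$, respectively. For an ideal $\mathcal I$, $\mathsf{cof}(\mathcal I)$ is the least cardinality of a family $\mathcal J\subseteq\mathcal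 I$ such that every member of $\mathcal I$ is contained in a member of $\mathcal J$; $\mathrm{cf}(\kappa)$ denotes the cofinality of a cardinal $\kappa$, and $\mathfrak c=2^{\aleph_0}$. Corollary. In ZFC, $$\mathrm{cf}(\mathsf{cof}(\ell^0))>\mathfrak c \quad\text{and}\quad \mathrm{cf}(\mathsf{cof}(m^0))>\mathfrak c .$$ In particular, $\mathsf{cof}(\ell^0)>\mathfrak c$ and $\mathsf{cof}(m^0)>\mathfrak c$. -/

import Mathlib

namespace TreeForcing

/-- The finite sequence `x ↾ n = (x 0, …, x (n - 1))`. -/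
def restrict (x : ℕ → ℕ) (n : ℕ) : List ℕ := (List.range n).map x

/-- The set `[T]` of (infinite) branches through a tree `T ⊆ ω^{<ω}`. Trees are Mathlib's
`Descriptive.tree ℕ`: sets of finite sequences closed under initial segments. -/
def branches (T : Descriptive.tree ℕ) : Set (ℕ → ℕ) := {x | ∀ n, restrict x n ∈ T}

/-- The set of immediate successors `{n : t ⌢ n ∈ T}` of the node `t` in `T`. -/
def succs (T : Descriptive.tree ℕ) (t : List ℕ) : Set ℕ := {n | t ++ [n] ∈ T}

/-- `s` is a node of `T` that is comparable with all nodes of `T`. -/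
def IsTrunkNode (T : Descriptive.tree ℕ) (s : List ℕ) : Prop :=
  s ∈ T ∧ ∀ t ∈ T, t <+: s ∨ s <+: t

/-- `s` is the stem of `T`: the longest node of `T` that is comparable with all nodes of `T`. -/
def IsStem (T : Descriptive.tree ℕ) (s : List ℕ) : Prop :=
  IsTrunkNode T s ∧ ∀ r, IsTrunkNode T r → r <+: s

/-- Laver forcing: the trees `T` that have a stem and such that every node of `T` extending
the stem has infinitely many immediate successors in `T`. -/
def laverForcing : Set (Descriptive.tree ℕ) :=
  {T | ∃ s, IsStem T s ∧ ∀ t ∈ T, s <+: t → (succs T t).Infinite}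

/-- Miller forcing: the nonempty trees `T` such that every node of `T` has an extension in `T`
with infinitely many immediate successors in `T`. -/
def millerForcing : Set (Descriptive.tree ℕ) :=
  {T | (∃ t, t ∈ T) ∧ ∀ t ∈ T, ∃ s ∈ T, t <+: s ∧ (succs T s).Infinite}

/-- The tree ideal associated with a family `𝕋` of trees (ordered by inclusion): all
`X ⊆ ω^ω` such that every `T ∈ 𝕋` has a subtree `S ∈ 𝕋` with `X ∩ [S] = ∅`. -/
def treeIdeal (𝕋 : Set (Descriptive.tree ℕ)) : Order.Ideal (Set (ℕ → ℕ)) where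
  carrier := {X | ∀ T ∈ 𝕋, ∃ S ∈ 𝕋, S ≤ T ∧ X ∩ branches S = ∅}
  lower' := by
    intro X Y hYX hX T hT
    obtain ⟨S, hS, hST, h⟩ := hX T hT
    exact ⟨S, hS, hST, Set.subset_eq_empty (Set.inter_subset_inter_left _ hYX) h⟩
  nonempty' := ⟨∅, fun T hT => ⟨T, hT, le_rfl, Set.empty_inter _⟩⟩
  directed' := by
    intro X hX Y hY
    refine ⟨X ∪ Y, ?_, Set.subset_union_left, Set.subset_union_right⟩
    intro T hT
    obtain ⟨S, hS, hST, h⟩ := hX T hT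
    obtain ⟨R, hR, hRS, h'⟩ := hY S hS
    refine ⟨R, hR, hRS.trans hST, ?_⟩
    have hb : branches R ⊆ branches S := fun x hx n => hRS (hx n)
    rw [Set.union_inter_distrib_right, h', Set.union_empty]
    exact Set.subset_eq_empty (Set.inter_subset_inter_right _ hb) h

/-- The Laver ideal `ℓ⁰`. -/
def laverIdeal : Order.Ideal (Set (ℕ → ℕ)) := treeIdeal laverForcing

/-- The Miller ideal `m⁰`. -/
def millerIdeal : Order.Ideal (Set (ℕ → ℕ)) := treeIdeal millerForcing

/-- The cofinality of an ideal `I` of sets: the least cardinality of a family `J ⊆ I` such that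
every member of `I` is contained in a member of `J`. -/
noncomputable def idealCof (I : Order.Ideal (Set (ℕ → ℕ))) : Cardinal.{0} := Order.cof I

end TreeForcing

namespace TreeForcing

open Filter
open scoped Cardinal

/-! Two facts carry the theorem, for both forcings at once via `IsLaverLike`. Below every tree there
is one on whose branches `parity` is constant or injective (`exists_parity_const_or_injOn`). And
each of the 𝔠 fibres of `parity` is a copy of Baire space under some `shift a`, along which members
of the ideal can be moved back and forth.

The diagonalization is `not_isCofinal_iUnion`. Given families `J a`, indexed by the 𝔠 fibres and
each smaller than the cofinality, put into fibre `a` a set from the ideal that no member of `J a`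
covers. Before that, reserve in fibre `a` a set `B a` of fewer than 𝔠 points, to be removed again.
The union over all fibres is in the ideal: on a tree where `parity` is constant only one fibre
counts, and on a tree where it is injective the removals leave fewer than 𝔠 points, which are
negligible by `mem_of_mk_lt`. So the union of the `J a` is not cofinal. Singletons `J a` give that
the cofinality exceeds 𝔠; initial segments of an enumerated cofinal family give the same for its own
cofinality.

For the dichotomy, a continuous map to Cantor space has limits at all finite sequences along
iterations of an ultrafilter. If from some node one can avoid all nodes whose successors' limits
vary, the map is constant on a Laver tree. Otherwise a strategy meets such nodes infinitely often,
and thinning the tree so that different nodes change the limits at different coordinates makes the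
map injective. Expansions transfer this from the full tree to subtrees of any given tree. -/

/-! ### Restrictions and recursively built branches -/

@[simp] theorem length_restrict (x : ℕ → ℕ) (n : ℕ) : (restrict x n).length = n := by
  simp [restrict]

theorem restrict_succ (x : ℕ → ℕ) (n : ℕ) : restrict x (n + 1) = restrict x n ++ [x n] := by
  simp [restrict, List.range_succ]

theorem take_restrict (x : ℕ → ℕ) {m n : ℕ} (h : m ≤ n) :
    (restrict x n).take m = restrict x m := by
  simp [restrict, ← List.map_take, List.take_range, h]

theorem restrict_prefix (x : ℕ → ℕ) {m n : ℕ} (h : m ≤ n) : restrict x m <+: restrict x n := by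
  rw [← take_restrict x h]
  exact List.take_prefix _ _

theorem restrict_length_of_prefix {x : ℕ → ℕ} {n : ℕ} {s : List ℕ} (h : s <+: restrict x n) :
    restrict x s.length = s := by
  have hl : s.length ≤ n := by simpa using h.length_le
  rw [List.prefix_iff_eq_take.1 h, List.length_take, length_restrict, min_eq_left hl,
    take_restrict x hl]

theorem restrict_eq_iff {x x' : ℕ → ℕ} {n : ℕ} :
    restrict x n = restrict x' n ↔ ∀ i < n, x i = x' i := by
  simp [restrict]

theorem prefix_restrict {x : ℕ → ℕ} {n : ℕ} {s : List ℕ} (h : restrict x s.length = s)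
    (hn : s.length ≤ n) : s <+: restrict x n := by
  rw [← h]
  exact restrict_prefix x (by simpa using hn)

theorem getD_restrict (x : ℕ → ℕ) {m n : ℕ} (h : m < n) : (restrict x n).getD m 0 = x m := by
  simp [restrict, h]

/-- An increasing sequence of finite sequences of unbounded length converges to an infinite
sequence. -/
theorem exists_forall_restrict_eq (u : ℕ → List ℕ) (hu : ∀ n, u n <+: u (n + 1))
    (hl : ∀ n, n ≤ (u n).length) : ∃ x : ℕ → ℕ, ∀ n, restrict x (u n).length = u n := by
  have mono : ∀ m n, m ≤ n → u m <+: u n := fun m n h => by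
    induction n, h using Nat.le_induction with
    | base => exact List.prefix_rfl
    | succ n _ ih => exact ih.trans (hu n)
  refine ⟨fun n => (u (n + 1)).getD n 0, fun n => ?_⟩
  refine List.ext_getElem (by simp) fun i h1 h2 => ?_
  have h3 : i < (u (i + 1)).length := hl (i + 1)
  have : (u (i + 1))[i] = (u n)[i] := by
    rcases le_total (i + 1) n with h | h
    · exact (mono _ _ h).getElem h3
    · exact ((mono _ _ h).getElem h2).symm
  simp [restrict, h3, this]

/-- A property of finite sequences that can always be preserved by adding one entry holds along an
infinite sequence. -/
theorem exists_branch {P : List ℕ → Prop} {t : List ℕ} (ht : P t)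
    (hP : ∀ s, P s → ∃ k, P (s ++ [k])) :
    ∃ x, restrict x t.length = t ∧ ∀ n, t.length ≤ n → P (restrict x n) := by
  choose! k hk using hP
  let u : ℕ → List ℕ := fun n => Nat.rec t (fun _ s => s ++ [k s]) n
  have hu : ∀ n, u (n + 1) = u n ++ [k (u n)] := fun n => rfl
  have hlen : ∀ n, (u n).length = t.length + n := fun n => by
    induction n with
    | zero => rfl
    | succ n ih => rw [hu]; simp [ih]; omega
  have hPu : ∀ n, P (u n) := fun n => by
    induction n with
    | zero => exact ht
    | succ n ih => rw [hu]; exact hk _ ih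
  obtain ⟨x, hx⟩ := exists_forall_restrict_eq u (fun n => by rw [hu]; exact List.prefix_append _ _)
    (fun n => by rw [hlen]; omega)
  refine ⟨x, hx 0, fun n hn => ?_⟩
  have := hx (n - t.length)
  rw [hlen, Nat.add_sub_cancel' hn] at this
  rw [this]
  exact hPu _

/-! ### Ultrafilter games and limits of continuous maps -/

/-- The infinite sequences `x` extending `t` such that `x n ∈ K (x ↾ n)` for all `n ≥ |t|`. -/
def branchesFrom (t : List ℕ) (K : List ℕ → Set ℕ) : Set (ℕ → ℕ) :=
  {x | restrict x t.length = t ∧ ∀ n, t.length ≤ n → x n ∈ K (restrict x n)}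

/-- `Reaches N t`: the game of extending `t`, where every move is taken from almost all numbers in
the sense of a fixed nonprincipal ultrafilter, leads to an element of `N`. -/
inductive Reaches (N : Set (List ℕ)) : List ℕ → Prop
  | base (t : List ℕ) (h : t ∈ N) : Reaches N t
  | step (t : List ℕ) (A : Set ℕ) (hA : A ∈ hyperfilter ℕ) (h : ∀ k ∈ A, Reaches N (t ++ [k])) :
      Reaches N t

/-- The game of extending `t` leads to a finite sequence all of whose continuations lie in `P`. -/
abbrev Decides (P : Set (ℕ → ℕ)) : List ℕ → Prop :=
  Reaches {t | ∀ x, restrict x t.length = t → x ∈ P}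

theorem Decides.exists_mem {P : Set (ℕ → ℕ)} {t : List ℕ} (h : Decides P t) :
    ∃ x ∈ P, restrict x t.length = t := by
  induction h with
  | base t h =>
    obtain ⟨x, hx, -⟩ := exists_branch (P := fun _ => True) (t := t) trivial fun _ _ => ⟨0, trivial⟩
    exact ⟨x, h x hx, hx⟩
  | step t A hA _ ih =>
    obtain ⟨k, hk⟩ := Filter.nonempty_of_mem hA
    obtain ⟨x, hxP, hx⟩ := ih k hk
    refine ⟨x, hxP, restrict_length_of_prefix (n := (t ++ [k]).length) ?_⟩
    rw [hx]
    exact List.prefix_append _ _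

/-- Two moves taken from ultrafilter sets can be made equal, so both strategies can be followed in a
common play. -/
theorem Decides.not_compl {P : Set (ℕ → ℕ)} {t : List ℕ} (h : Decides P t) : ¬ Decides Pᶜ t := by
  induction h with
  | base t h =>
    intro h'
    obtain ⟨x, hxP, hx⟩ := Decides.exists_mem h'
    exact hxP (h x hx)
  | step t A hA h ih =>
    intro h'
    cases h' with
    | base _ h' =>
      obtain ⟨x, hxP, hx⟩ := Decides.exists_mem (.step t A hA h)
      exact h' x hx hxP
    | step _ A' hA' h' =>
      obtain ⟨k, hk, hk'⟩ := Filter.nonempty_of_mem (inter_mem hA hA')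
      exact ih k hk (h' k hk')

/-- Determinacy for clopen `P`: an undecided node has an undecided successor, and an infinite
undecided branch would contradict that membership in `P` is settled by a finite part. -/
theorem decides_or_compl {P : Set (ℕ → ℕ)}
    (hP : ∀ x, ∃ m, ∀ x', restrict x' m = restrict x m → (x' ∈ P ↔ x ∈ P)) (t : List ℕ) :
    Decides P t ∨ Decides Pᶜ t := by
  by_contra hbad
  obtain ⟨x, hxt, hx⟩ := exists_branch (P := fun s => ¬ (Decides P s ∨ Decides Pᶜ s)) hbad
    fun s hs => by
      by_contra! hcon
      have : {k | Decides P (s ++ [k])} ∪ {k | Decides Pᶜ (s ++ [k])} ∈ hyperfilter ℕ :=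
        univ_mem' hcon
      rcases Ultrafilter.union_mem_iff.1 this with h | h
      · exact hs (Or.inl (.step s _ h fun _ h => h))
      · exact hs (Or.inr (.step s _ h fun _ h => h))
  obtain ⟨m, hm⟩ := hP x
  refine hx (max m t.length) (le_max_right _ _) ?_
  have key : ∀ x', restrict x' (restrict x (max m t.length)).length = restrict x (max m t.length) →
      (x' ∈ P ↔ x ∈ P) := fun x' h => hm x' <| by
    rw [length_restrict] at h
    rw [← take_restrict x (le_max_left m t.length), ← h, take_restrict x' (le_max_left _ _)]
  by_cases hxP : x ∈ P
  · exact Or.inl (.base _ fun x' h => (key x' h).2 hxP)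
  · exact Or.inr (.base _ fun x' h h' => hxP ((key x' h).1 h'))

/-- A continuous `g` from Baire space to Cantor space, presented by its moduli of continuity. -/
def IsCont (g : (ℕ → ℕ) → ℕ → Bool) : Prop :=
  ∀ x n, ∃ m, ∀ x', restrict x' m = restrict x m → g x' n = g x n

/-- Every continuous map to Cantor space has limits `y t` at all finite sequences `t`, along the
iterations of a fixed nonprincipal ultrafilter. -/
theorem IsCont.exists_limits {g : (ℕ → ℕ) → ℕ → Bool} (hg : IsCont g) :
    ∃ y : List ℕ → ℕ → Bool,
      (∀ t n, ∀ᶠ k in (hyperfilter ℕ : Filter ℕ), y (t ++ [k]) n = y t n) ∧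
      ∀ x n, ∃ m, ∀ m', m ≤ m' → y (restrict x m') n = g x n := by
  classical
  let P : ℕ → Set (ℕ → ℕ) := fun n => {x | g x n = true}
  have hP : ∀ n x, ∃ m, ∀ x', restrict x' m = restrict x m → (x' ∈ P n ↔ x ∈ P n) := fun n x => by
    obtain ⟨m, hm⟩ := hg x n
    exact ⟨m, fun x' h => by simp [P, hm x' h]⟩
  -- Bit `n` of the limit at `t` is the value of bit `n` of `g` that can be forced in the game from
  -- `t`.
  let y : List ℕ → ℕ → Bool := fun t n => decide (Decides (P n) t)
  have yt : ∀ t n, Decides (P n) t → y t n = true := fun t n h => by simp [y, h]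
  have yf : ∀ t n, Decides (P n)ᶜ t → y t n = false := fun t n h => by
    have : ¬ Decides (P n) t := fun h' => Decides.not_compl h' h
    simp [y, this]
  refine ⟨y, fun t n => ?_, fun x n => ?_⟩
  · by_cases h : ∀ᶠ k in (hyperfilter ℕ : Filter ℕ), Decides (P n) (t ++ [k])
    · rw [yt t n (.step t _ h fun _ h => h)]
      exact h.mono fun k hk => yt _ _ hk
    · have h' : ∀ᶠ k in (hyperfilter ℕ : Filter ℕ), Decides (P n)ᶜ (t ++ [k]) :=
        (Ultrafilter.eventually_not.2 h).mono fun k hk =>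
          (decides_or_compl (hP n) _).resolve_left hk
      rw [yf t n (.step t _ h' fun _ h => h)]
      exact h'.mono fun k hk => yf _ _ hk
  · obtain ⟨m, hm⟩ := hg x n
    refine ⟨m, fun m' hm' => ?_⟩
    have key : ∀ x', restrict x' (restrict x m').length = restrict x m' → g x' n = g x n :=
      fun x' h => hm x' <| by
        rw [length_restrict] at h
        rw [← take_restrict x hm', ← h, take_restrict x' hm']
    cases hgx : g x n with
    | true => exact yt _ _ (.base _ fun x' h => (key x' h).trans hgx)
    | false => exact yf _ _ (.base _ fun x' h => by simp [P, key x' h, hgx])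

/-! ### Disjoint refinements and strategies -/

/-- Countably many infinite sets of natural numbers have a disjoint refinement. -/
theorem exists_disjoint_refinement {ι : Type*} [Countable ι] (L : ι → Set ℕ)
    (hL : ∀ i, (L i).Infinite) :
    ∃ L' : ι → Set ℕ, (∀ i, L' i ⊆ L i) ∧ (∀ i, (L' i).Infinite) ∧
      ∀ i j n, n ∈ L' i → n ∈ L' j → i = j := by
  rcases isEmpty_or_nonempty ι with hι | hι
  · exact ⟨L, fun _ => le_rfl, hL, fun i => isEmptyElim i⟩
  obtain ⟨f, hf⟩ := exists_surjective_nat ι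
  -- Every index occurs infinitely often in `s`; a strictly increasing choice of elements then never
  -- uses a number twice.
  let s : ℕ → ι := fun j => f (Nat.unpair j).1
  have hex : ∀ i M, ∃ n ∈ L i, M < n := fun i M => (hL i).exists_gt M
  choose c hc hcM using hex
  let h : ℕ → ℕ := fun j => Nat.rec (c (s 0) 0) (fun j v => c (s (j + 1)) v) j
  have hs : ∀ j, h j ∈ L (s j) := fun j => by
    cases j with
    | zero => exact hc _ _
    | succ j => exact hc _ _
  have hmono : StrictMono h := strictMono_nat_of_lt_succ fun j => hcM _ _
  refine ⟨fun i => h '' {j | s j = i}, ?_, fun i => ?_, ?_⟩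
  · rintro i _ ⟨j, rfl, rfl⟩
    exact hs j
  · refine Set.Infinite.image hmono.injective.injOn ?_
    obtain ⟨a, rfl⟩ := hf i
    refine Set.infinite_of_injective_forall_mem (f := fun b => Nat.pair a b) ?_ fun b => ?_
    · intro b b' hb
      simpa using hb
    · simp [s]
  · rintro i j _ ⟨a, rfl, rfl⟩ ⟨b, rfl, hb⟩
    rw [hmono.injective hb]

theorem infinite_of_mem_hyperfilter {A : Set ℕ} (hA : A ∈ hyperfilter ℕ) : A.Infinite := fun h =>
  h.notMem_hyperfilter hA

/-- A winning strategy in the game of `Reaches`. -/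
theorem Reaches.exists_strategy {N : Set (List ℕ)} {t : List ℕ} (h : Reaches N t) :
    ∃ K : List ℕ → Set ℕ, (∀ s, K s ∈ hyperfilter ℕ) ∧
      ∀ x ∈ branchesFrom t K, ∃ n, t.length ≤ n ∧ restrict x n ∈ N := by
  classical
  induction h with
  | base t h =>
    exact ⟨fun _ => Set.univ, fun _ => univ_mem, fun x hx => ⟨t.length, le_rfl, by rwa [hx.1]⟩⟩
  | step t A hA _ ih =>
    choose! K hK hKx using ih
    -- The entry at position `t.length` is the first move; it selects which of the later strategies
    -- to follow.
    refine ⟨fun s => if t.length < s.length ∧ s.getD t.length 0 ∈ A then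
      K (s.getD t.length 0) s else A, fun s => ?_, fun x hx => ?_⟩
    · dsimp only
      split_ifs with hs
      · exact hK _ hs.2 s
      · exact hA
    · have hxA : x t.length ∈ A := by simpa using hx.2 t.length le_rfl
      have hx' : x ∈ branchesFrom (t ++ [x t.length]) (K (x t.length)) := by
        refine ⟨?_, fun n hn => ?_⟩
        · rw [List.length_append, List.length_singleton, restrict_succ, hx.1]
        · have hn' : t.length < n := by simpa using hn
          have := hx.2 n hn'.le
          simpa only [length_restrict, getD_restrict x hn', hn', hxA, and_self, if_true] using this
      obtain ⟨n, hn, hxn⟩ := hKx (x t.length) hxA x hx'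
      exact ⟨n, Nat.le_of_succ_le (by simpa using hn), hxn⟩

/-- If `N` can be reached from everywhere, then there is a single strategy that visits `N`
infinitely often. -/
theorem exists_strategy_infinitely_often {N : Set (List ℕ)} (h : ∀ t, Reaches N t) :
    ∃ K : List ℕ → Set ℕ, (∀ s, K s ∈ hyperfilter ℕ) ∧
      ∀ x ∈ branchesFrom [] K, ∀ m, ∃ n, m ≤ n ∧ restrict x n ∈ N := by
  choose K hK hKx using fun t => (h t).exists_strategy
  -- At `s`, the strategies started at all initial segments of `s` are obeyed together; there are
  -- finitely many, so the intersection stays in the ultrafilter.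
  refine ⟨fun s => ⋂ i ∈ Set.Iic s.length, K (s.take i) s, fun s => ?_, fun x hx m => ?_⟩
  · exact (biInter_mem (Set.finite_Iic _)).2 fun i _ => hK _ _
  · have hx' : x ∈ branchesFrom (restrict x m) (K (restrict x m)) := by
      refine ⟨by rw [length_restrict], fun n hn => ?_⟩
      rw [length_restrict] at hn
      have := Set.mem_iInter₂.1 (hx.2 n (Nat.zero_le n)) m (by simpa using hn)
      rwa [take_restrict x hn] at this
    obtain ⟨n, hn, hxn⟩ := hKx (restrict x m) x hx'
    exact ⟨n, by simpa using hn, hxn⟩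

/-! ### The dichotomy: constant or injective on a Laver tree -/

/-- A node is constant for the limits `y` if almost all of its successors have the same limit. -/
def IsConstNode (y : List ℕ → ℕ → Bool) (t : List ℕ) : Prop :=
  ∀ᶠ k in (hyperfilter ℕ : Filter ℕ), y (t ++ [k]) = y t

open PiNat in
/-- A bound for the places where the limits change along the path to `s`. -/
noncomputable def changeBound (y : List ℕ → ℕ → Bool) (s : List ℕ) : ℕ :=
  ∑ i ∈ Finset.range s.length, firstDiff (E := fun _ => Bool) (y (s.take i)) (y (s.take (i + 1)))

theorem firstDiff_le_changeBound (y : List ℕ → ℕ → Bool) (x : ℕ → ℕ) {m n : ℕ} (h : m < n) :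
    PiNat.firstDiff (E := fun _ => Bool) (y (restrict x m)) (y (restrict x (m + 1))) ≤
      changeBound y (restrict x n) := by
  have := Finset.single_le_sum (s := Finset.range (restrict x n).length)
    (f := fun i => PiNat.firstDiff (E := fun _ => Bool) (y ((restrict x n).take i))
      (y ((restrict x n).take (i + 1)))) (fun _ _ => Nat.zero_le _) (a := m) (by simpa using h)
  rw [take_restrict x h.le, take_restrict x h] at this
  exact this

variable {g : (ℕ → ℕ) → ℕ → Bool} {y : List ℕ → ℕ → Bool}

/-- A node from which no nonconstant node is reachable is itself constant, and almost all its
successors inherit the unreachability. Staying among these keeps the limit equal to `y t` forever.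
-/
theorem exists_const_of_not_reaches
    (hg : ∀ x n, ∃ m, ∀ m', m ≤ m' → y (restrict x m') n = g x n) {t : List ℕ}
    (ht : ¬ Reaches {s | ¬ IsConstNode y s} t) :
    ∃ K : List ℕ → Set ℕ, (∀ s, (K s).Infinite) ∧ ∀ x ∈ branchesFrom t K, g x = y t := by
  set N := {s | ¬ IsConstNode y s}
  refine ⟨fun s => {k | ¬ Reaches N s → ¬ Reaches N (s ++ [k]) ∧ y (s ++ [k]) = y s},
    fun s => ?_, fun x hx => ?_⟩
  · by_cases hs : Reaches N s
    · simpa [hs] using Set.infinite_univ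
    · have h1 : ∀ᶠ k in (hyperfilter ℕ : Filter ℕ), ¬ Reaches N (s ++ [k]) :=
        Ultrafilter.eventually_not.2 fun h => hs (.step s _ h fun _ h => h)
      have h2 : IsConstNode y s := by
        by_contra h2
        exact hs (.base s h2)
      exact infinite_of_mem_hyperfilter ((h1.and h2).mono fun k hk _ => hk)
  · have key : ∀ n, t.length ≤ n →
        ¬ Reaches N (restrict x n) ∧ y (restrict x n) = y t := fun n hn => by
      induction n, hn using Nat.le_induction with
      | base => rw [hx.1]; exact ⟨ht, rfl⟩
      | succ n hn ih =>
        obtain ⟨h1, h2⟩ := hx.2 n hn ih.1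
        rw [restrict_succ]
        exact ⟨h1, h2.trans ih.2⟩
    funext n
    obtain ⟨m, hm⟩ := hg x n
    rw [← hm _ (le_max_left m t.length), (key _ (le_max_right m t.length)).2]

open PiNat in
/-- The branching sets of a tree on which `g` is injective: at nonconstant nodes, the limits of
the successors differ from the limit of the node for the first time at different places, and these
places are different for different nodes and increase along branches. -/
theorem exists_branching_sets
    (hy : ∀ t n, ∀ᶠ k in (hyperfilter ℕ : Filter ℕ), y (t ++ [k]) n = y t n)
    {K : List ℕ → Set ℕ} (hK : ∀ s, K s ∈ hyperfilter ℕ) :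
    ∃ (K' : List ℕ → Set ℕ) (L : List ℕ → Set ℕ), (∀ s, (K' s).Infinite) ∧ (∀ s, K' s ⊆ K s) ∧
      (∀ s s' n, n ∈ L s → n ∈ L s' → s = s') ∧
      (∀ s, IsConstNode y s → ∀ k ∈ K' s, y (s ++ [k]) = y s) ∧
      ∀ s, ¬ IsConstNode y s →
        (∀ k ∈ K' s, y (s ++ [k]) ≠ y s ∧
          firstDiff (E := fun _ => Bool) (y s) (y (s ++ [k])) ∈ L s ∧
          changeBound y s < firstDiff (E := fun _ => Bool) (y s) (y (s ++ [k]))) ∧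
        Set.InjOn (fun k => firstDiff (E := fun _ => Bool) (y s) (y (s ++ [k]))) (K' s) := by
  classical
  let D : List ℕ → ℕ → ℕ := fun s k => firstDiff (E := fun _ => Bool) (y s) (y (s ++ [k]))
  -- Exceeding `changeBound` ensures that a later change never disturbs the coordinates at which
  -- earlier nodes changed the limit.
  let C : List ℕ → Set ℕ := fun s => {k | k ∈ K s ∧ y (s ++ [k]) ≠ y s ∧ changeBound y s < D s k}
  have hC : ∀ s, ¬ IsConstNode y s → (D s '' C s).Infinite := fun s hs => by
    refine Set.infinite_of_forall_exists_gt fun M => ?_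
    have h1 : ∀ᶠ k in (hyperfilter ℕ : Filter ℕ), y (s ++ [k]) ≠ y s :=
      Ultrafilter.eventually_not.2 hs
    have h2 : ∀ᶠ k in (hyperfilter ℕ : Filter ℕ),
        ∀ i ∈ Set.Iic (max M (changeBound y s)), y (s ++ [k]) i = y s i :=
      (eventually_all_finite (Set.finite_Iic _)).2 fun i _ => hy s i
    obtain ⟨k, ⟨hk1, hk2⟩, hk3⟩ := ((h1.and h2).and (hK s)).exists
    have hD : max M (changeBound y s) < D s k := by
      by_contra! hle
      exact apply_firstDiff_ne hk1.symm (hk2 _ hle).symm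
    exact ⟨D s k, ⟨k, ⟨hk3, hk1, (le_max_right _ _).trans_lt hD⟩, rfl⟩,
      (le_max_left _ _).trans_lt hD⟩
  obtain ⟨L, hLsub, hLinf, hLdisj⟩ := exists_disjoint_refinement
    -- The value at constant nodes is a dummy that keeps the whole family infinite.
    (fun s => if IsConstNode y s then Set.univ else D s '' C s) fun s => by
      split_ifs with hs
      · exact Set.infinite_univ
      · exact hC s hs
  have hL : ∀ s, ¬ IsConstNode y s → ∀ n ∈ L s, ∃ k ∈ C s, D s k = n := fun s hs n hn => by
    simpa [hs] using hLsub s hn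
  choose! k hkC hkD using hL
  refine ⟨fun s => if IsConstNode y s then K s ∩ {k | y (s ++ [k]) = y s} else k s '' L s, L,
    fun s => ?_, fun s => ?_, hLdisj, fun s hs j hj => ?_, fun s hs => ⟨fun j hj => ?_, ?_⟩⟩
  · dsimp only
    split_ifs with hs
    · exact infinite_of_mem_hyperfilter (inter_mem (hK s) hs)
    · refine (hLinf s).image fun n hn n' hn' h => ?_
      rw [← hkD s hs n hn, ← hkD s hs n' hn', h]
  · dsimp only
    split_ifs with hs
    · exact Set.inter_subset_left
    · rintro _ ⟨n, hn, rfl⟩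
      exact (hkC s hs n hn).1
  · simp only [if_pos hs] at hj
    exact hj.2
  · simp only [if_neg hs] at hj
    obtain ⟨n, hn, rfl⟩ := hj
    refine ⟨(hkC s hs n hn).2.1, ?_, (hkC s hs n hn).2.2⟩
    change D s _ ∈ _
    rwa [hkD s hs n hn]
  · simp only [if_neg hs]
    rintro _ ⟨n, hn, rfl⟩ _ ⟨n', hn', rfl⟩ h
    change D s _ = D s _ at h
    rw [hkD s hs n hn, hkD s hs n' hn'] at h
    rw [h]

open PiNat in
-- If `g x = g x'` and `x`, `x'` split at `m`, the first place where this common value differs from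
-- the limit at the splitting node identifies the next nonconstant node on each branch and the exit
-- taken there. Hence both branches have the same node and exit, which contradicts the splitting at
-- `m`.
theorem exists_injOn_of_reaches
    (hy : ∀ t n, ∀ᶠ k in (hyperfilter ℕ : Filter ℕ), y (t ++ [k]) n = y t n)
    (hg : ∀ x n, ∃ m, ∀ m', m ≤ m' → y (restrict x m') n = g x n)
    (h : ∀ t, Reaches {s | ¬ IsConstNode y s} t) :
    ∃ K : List ℕ → Set ℕ, (∀ s, (K s).Infinite) ∧ Set.InjOn g (branchesFrom [] K) := by
  classical
  obtain ⟨K₀, hK₀, hK₀x⟩ := exists_strategy_infinitely_often h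
  obtain ⟨K, L, hKinf, hKK₀, hL, hconst, hnon⟩ := exists_branching_sets hy hK₀
  refine ⟨K, hKinf, ?_⟩
  -- The node at `p` is the first nonconstant one from `m` on: limits do not move before `p`, and
  -- after `p` they move only beyond the coordinate changed at `p`.
  have first : ∀ x ∈ branchesFrom [] K, ∀ m, ∃ p, m ≤ p ∧ ¬ IsConstNode y (restrict x p) ∧
      firstDiff (E := fun _ => Bool) (y (restrict x m)) (g x) =
        firstDiff (E := fun _ => Bool) (y (restrict x p)) (y (restrict x p ++ [x p])) := by
    intro x hx m
    have hxK : ∀ n, x n ∈ K (restrict x n) := fun n => hx.2 n (Nat.zero_le n)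
    have hex : ∃ p, m ≤ p ∧ ¬ IsConstNode y (restrict x p) :=
      hK₀x x ⟨hx.1, fun n hn => hKK₀ _ (hx.2 n hn)⟩ m
    let p := Nat.find hex
    obtain ⟨hmp, hp⟩ := Nat.find_spec hex
    change m ≤ p at hmp
    change ¬ IsConstNode y (restrict x p) at hp
    have heq : ∀ q, m ≤ q → q ≤ p → y (restrict x q) = y (restrict x m) := fun q hq => by
      induction q, hq using Nat.le_induction with
      | base => exact fun _ => rfl
      | succ q hq ih =>
        intro hqp
        have hc : IsConstNode y (restrict x q) := by
          by_contra hc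
          exact Nat.find_min hex hqp ⟨hq, hc⟩
        rw [restrict_succ, hconst _ hc _ (hxK q), ih (by omega)]
    have hyp := heq p hmp le_rfl
    obtain ⟨hne, -, -⟩ := (hnon _ hp).1 _ (hxK p)
    set n := firstDiff (E := fun _ => Bool) (y (restrict x p)) (y (restrict x p ++ [x p])) with hn
    have hlate : ∀ q, p + 1 ≤ q → ∀ i ≤ n, y (restrict x q) i = y (restrict x (p + 1)) i :=
        fun q hq => by
      induction q, hq using Nat.le_induction with
      | base => exact fun _ _ => rfl
      | succ q hq ih =>
        intro i hi
        rw [← ih i hi]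
        by_cases hc : IsConstNode y (restrict x q)
        · rw [restrict_succ, hconst _ hc _ (hxK q)]
        · have h1 := ((hnon _ hc).1 _ (hxK q)).2.2
          have h2 := firstDiff_le_changeBound y x (m := p) (n := q) hq
          rw [restrict_succ, ← hn] at h2
          rw [restrict_succ]
          exact (apply_eq_of_lt_firstDiff (E := fun _ => Bool)
            (hi.trans_lt (h2.trans_lt h1))).symm
    have hgx : ∀ i ≤ n, g x i = y (restrict x p ++ [x p]) i := fun i hi => by
      obtain ⟨M, hM⟩ := hg x i
      rw [← hM _ (le_max_left M (p + 1)), hlate _ (le_max_right _ _) i hi, restrict_succ]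
    have hlt : ∀ i < n, y (restrict x m) i = g x i := fun i hi => by
      rw [hgx i hi.le, ← hyp]
      exact apply_eq_of_lt_firstDiff (E := fun _ => Bool) hi
    have hnn : y (restrict x m) n ≠ g x n := by
      rw [hgx n le_rfl, ← hyp]
      exact apply_firstDiff_ne (E := fun _ => Bool) hne.symm
    have hgne : g x ≠ y (restrict x m) := fun h => hnn (by rw [h])
    refine ⟨p, hmp, hp, le_antisymm ?_ ?_⟩
    · by_contra! hlt'
      exact hnn (apply_eq_of_lt_firstDiff (E := fun _ => Bool) hlt')
    · by_contra! hlt'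
      exact apply_firstDiff_ne (E := fun _ => Bool) hgne.symm (hlt _ hlt')
  intro x hx x' hx' hxx'
  by_contra hne
  set m := firstDiff (E := fun _ => ℕ) x x' with hm
  have hres : restrict x m = restrict x' m :=
    restrict_eq_iff.2 fun i hi => apply_eq_of_lt_firstDiff (E := fun _ => ℕ) hi
  obtain ⟨p, hmp, hp, hfp⟩ := first x hx m
  obtain ⟨p', hmp', hp', hfp'⟩ := first x' hx' m
  have hsame : firstDiff (E := fun _ => Bool) (y (restrict x p)) (y (restrict x p ++ [x p])) =
      firstDiff (E := fun _ => Bool) (y (restrict x' p')) (y (restrict x' p' ++ [x' p'])) := by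
    rw [← hfp, ← hfp', hres, hxx']
  have h1 := ((hnon _ hp).1 _ (hx.2 p (Nat.zero_le p))).2.1
  have h2 := ((hnon _ hp').1 _ (hx'.2 p' (Nat.zero_le p'))).2.1
  rw [← hsame] at h2
  have hnode := hL _ _ _ h1 h2
  have hpp' : p = p' := by simpa using congrArg List.length hnode
  subst hpp'
  have hkk : x p = x' p := by
    refine (hnon _ hp).2 (hx.2 p (Nat.zero_le p)) ?_ ?_
    · rw [hnode]; exact hx'.2 p (Nat.zero_le p)
    · change firstDiff (E := fun _ => Bool) _ _ = firstDiff (E := fun _ => Bool) _ _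
      rw [hsame, hnode]
  have hmne : x m ≠ x' m := apply_firstDiff_ne (E := fun _ => ℕ) hne
  -- If `p = m`, equal exits contradict `x m ≠ x' m`; if `p > m`, equal nodes already do.
  rcases hmp.eq_or_lt with h | h
  · rw [h] at hmne
    exact hmne hkk
  · exact hmne (restrict_eq_iff.1 hnode m h)

/-- Every continuous map from Baire space to Cantor space is constant or injective on the branches
of some Laver tree. -/
theorem IsCont.exists_const_or_injOn (hg : IsCont g) :
    ∃ (t : List ℕ) (K : List ℕ → Set ℕ), (∀ s, (K s).Infinite) ∧
      ((∃ a, ∀ x ∈ branchesFrom t K, g x = a) ∨ Set.InjOn g (branchesFrom t K)) := by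
  obtain ⟨y, hy, hlim⟩ := hg.exists_limits
  by_cases h : ∀ t, Reaches {s | ¬ IsConstNode y s} t
  · obtain ⟨K, hK, hinj⟩ := exists_injOn_of_reaches hy hlim h
    exact ⟨[], K, hK, Or.inr hinj⟩
  · obtain ⟨t, ht⟩ := not_forall.1 h
    obtain ⟨K, hK, hconst⟩ := exists_const_of_not_reaches hlim ht
    exact ⟨t, K, hK, Or.inl ⟨y t, hconst⟩⟩

theorem mem_of_prefix {T : Descriptive.tree ℕ} {s t : List ℕ} (h : s <+: t) (ht : t ∈ T) : s ∈ T :=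
  Descriptive.Tree.mem_of_prefix h ht

/-! ### Expansions of the full tree -/

/-- The nodes of the tree whose branches are `branchesFrom t K`. -/
def nodesFrom (t : List ℕ) (K : List ℕ → Set ℕ) : Set (List ℕ) :=
  {s | (s <+: t ∨ t <+: s) ∧ ∀ r k, t <+: r → r ++ [k] <+: s → k ∈ K r}

section nodesFrom
variable {t s r : List ℕ} {K : List ℕ → Set ℕ}

theorem self_mem_nodesFrom : t ∈ nodesFrom t K := by
  refine ⟨Or.inl List.prefix_rfl, fun r k h h' => ?_⟩
  have h1 := h.length_le
  have h2 := h'.length_le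
  simp at h2
  omega

theorem mem_nodesFrom_of_prefix (h : r <+: s) (hs : s ∈ nodesFrom t K) : r ∈ nodesFrom t K := by
  refine ⟨?_, fun r' k h1 h2 => hs.2 r' k h1 (h2.trans h)⟩
  rcases hs.1 with h' | h'
  · exact Or.inl (h.trans h')
  · exact List.prefix_or_prefix_of_prefix h h'

theorem append_mem_nodesFrom (hs : s ∈ nodesFrom t K) (ht : t <+: s) {k : ℕ} (hk : k ∈ K s) :
    s ++ [k] ∈ nodesFrom t K := by
  refine ⟨Or.inr (ht.trans (List.prefix_append _ _)), fun r j hr h => ?_⟩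
  rcases List.prefix_concat_iff.1 h with h | h
  · obtain ⟨rfl, rfl⟩ : r = s ∧ j = k := by simpa using h
    exact hk
  · exact hs.2 r j hr h

theorem exists_mem_nodesFrom_of_mem (hs : s ∈ nodesFrom t K) :
    ∃ s' ∈ nodesFrom t K, t <+: s' ∧ s <+: s' := by
  rcases hs.1 with h | h
  · exact ⟨t, self_mem_nodesFrom, List.prefix_rfl, h⟩
  · exact ⟨s, hs, h, List.prefix_rfl⟩

end nodesFrom

/-- `e` embeds the full tree into finite sequences, with splitting of `s` given by `c s`. -/
def IsExpansion (c : List ℕ → ℕ → ℕ) (e : List ℕ → List ℕ) : Prop :=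
  ∀ s, Function.Injective (c s) ∧ ∀ i, e s ++ [c s i] <+: e (s ++ [i])

/-- The tree generated by the image under `e` of `nodesFrom t K`. -/
def imageTree (e : List ℕ → List ℕ) (t : List ℕ) (K : List ℕ → Set ℕ) : Descriptive.tree ℕ :=
  ⟨{u | ∃ s ∈ nodesFrom t K, u <+: e s}, fun _ _ ⟨s, hs, h⟩ =>
    ⟨s, hs, (List.prefix_append _ _).trans h⟩⟩

section IsExpansion
variable {c : List ℕ → ℕ → ℕ} {e : List ℕ → List ℕ}

theorem IsExpansion.mono (he : IsExpansion c e) {s s' : List ℕ} (h : s <+: s') :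
    e s <+: e s' := by
  obtain ⟨r, rfl⟩ := h
  induction r using List.reverseRecOn with
  | nil => simp
  | append_singleton r i ih =>
    rw [← List.append_assoc]
    exact ih.trans ((List.prefix_append _ _).trans ((he _).2 i))

theorem IsExpansion.length_le (he : IsExpansion c e) (s : List ℕ) : s.length ≤ (e s).length := by
  induction s using List.reverseRecOn with
  | nil => simp
  | append_singleton r i ih =>
    have := ((he r).2 i).length_le
    simp at this ⊢
    omega

theorem eq_of_append_prefix {u v : List ℕ} {i j : ℕ} (hi : u ++ [i] <+: v) (hj : u ++ [j] <+: v) :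
    i = j := by
  have := (List.prefix_of_prefix_length_le hi hj (by simp)).eq_of_length (by simp)
  simpa using this

theorem exists_append_prefix {s s' : List ℕ} (h : s <+: s') (hne : s ≠ s') :
    ∃ i, s ++ [i] <+: s' := by
  obtain ⟨r, rfl⟩ := h
  cases r with
  | nil => simp at hne
  | cons i r => exact ⟨i, r, by simp⟩

theorem IsExpansion.prefix_of_prefix (he : IsExpansion c e) {s s' : List ℕ} (h : e s <+: e s') :
    s <+: s' := by
  induction s using List.reverseRecOn with
  | nil => exact List.nil_prefix
  | append_singleton r i ih =>
    have h1 := (he r).2 i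
    have hr := ih (((List.prefix_append _ _).trans h1).trans h)
    have hne : r ≠ s' := by
      rintro rfl
      have := (h1.trans h).length_le
      simp at this
    obtain ⟨j, hj⟩ := exists_append_prefix hr hne
    have h2 := ((he r).2 j).trans (he.mono hj)
    rwa [(he r).1 (eq_of_append_prefix (h1.trans h) h2)]

/-- The map of infinite sequences induced by an expansion. -/
theorem IsExpansion.exists_map (he : IsExpansion c e) :
    ∃ φ : (ℕ → ℕ) → ℕ → ℕ, ∀ x n, restrict (φ x) (e (restrict x n)).length = e (restrict x n) := by
  choose φ hφ using fun x => exists_forall_restrict_eq (fun n => e (restrict x n))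
    (fun n => he.mono (restrict_prefix x n.le_succ))
    (fun n => by simpa using he.length_le (restrict x n))
  exact ⟨φ, hφ⟩

variable {φ : (ℕ → ℕ) → ℕ → ℕ}

/-- Since `e s` is at least as long as `s`, the induced map is continuous with modulus `n + 1`. -/
theorem IsExpansion.map_apply_congr (he : IsExpansion c e)
    (hφ : ∀ x n, restrict (φ x) (e (restrict x n)).length = e (restrict x n)) {x x' : ℕ → ℕ} {n : ℕ}
    (h : restrict x (n + 1) = restrict x' (n + 1)) : φ x n = φ x' n := by
  have h1 := hφ x (n + 1)
  rw [h, ← hφ x' (n + 1)] at h1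
  refine restrict_eq_iff.1 ?_ n (n.lt_succ_self.trans_le
    ((length_restrict x' (n + 1)).ge.trans (he.length_le (restrict x' (n + 1)))))
  simpa using h1

theorem IsExpansion.map_injective (he : IsExpansion c e)
    (hφ : ∀ x n, restrict (φ x) (e (restrict x n)).length = e (restrict x n)) :
    Function.Injective φ := by
  intro x x' h
  funext n
  have h1 : e (restrict x (n + 1)) <+:
      restrict (φ x) (max (e (restrict x (n + 1))).length (e (restrict x' (n + 1))).length) :=
    prefix_restrict (hφ x _) (le_max_left _ _)
  have h2 : e (restrict x' (n + 1)) <+: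
      restrict (φ x) (max (e (restrict x (n + 1))).length (e (restrict x' (n + 1))).length) := by
    rw [h]
    exact prefix_restrict (hφ x' _) (le_max_right _ _)
  have : restrict x (n + 1) = restrict x' (n + 1) := by
    rcases List.prefix_or_prefix_of_prefix h1 h2 with h | h
    · exact (he.prefix_of_prefix h).eq_of_length (by simp)
    · exact ((he.prefix_of_prefix h).eq_of_length (by simp)).symm
  exact restrict_eq_iff.1 this n n.lt_succ_self

theorem IsExpansion.branches_imageTree_subset (he : IsExpansion c e)
    (hφ : ∀ x n, restrict (φ x) (e (restrict x n)).length = e (restrict x n)) {t : List ℕ}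
    {K : List ℕ → Set ℕ} : branches (imageTree e t K) ⊆ φ '' branchesFrom t K := by
  intro y hy
  -- A branch passing through `e s` must leave it along some `c s i`, because `e` reflects the
  -- prefix order.
  have ext : ∀ s, restrict y (e s).length = e s → ∀ m, (e s).length < m →
      ∃ i, s ++ [i] ∈ nodesFrom t K ∧ y (e s).length = c s i ∧
        ∃ s' ∈ nodesFrom t K, s ++ [i] <+: s' ∧ restrict y m <+: e s' := by
    intro s hs m hm
    obtain ⟨s', hs', h⟩ := hy m
    have hss' : s <+: s' := he.prefix_of_prefix ((prefix_restrict hs hm.le).trans h)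
    have hne : s ≠ s' := by
      rintro rfl
      have := h.length_le
      simp at this
      omega
    obtain ⟨i, hi⟩ := exists_append_prefix hss' hne
    refine ⟨i, mem_nodesFrom_of_prefix hi hs', ?_, s', hs', hi, h⟩
    have h1 := ((he s).2 i).trans (he.mono hi)
    have h2 : e s ++ [y (e s).length] <+: e s' := by
      have := (restrict_prefix y hm).trans h
      rwa [Nat.succ_eq_add_one, restrict_succ, hs] at this
    exact eq_of_append_prefix h2 h1
  obtain ⟨x, -, hx⟩ := exists_branch (t := [])
    (P := fun s => s ∈ nodesFrom t K ∧ restrict y (e s).length = e s)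
    ⟨mem_nodesFrom_of_prefix List.nil_prefix self_mem_nodesFrom, by
      obtain ⟨s', -, h⟩ := hy (e []).length
      have h' := he.mono (List.nil_prefix (l := s'))
      exact (List.prefix_of_prefix_length_le h h' (by simp)).eq_of_length (by simp)⟩
    (by
      rintro s ⟨-, hs⟩
      obtain ⟨i, hi, hyi, -⟩ := ext s hs _ (Nat.lt_succ_self _)
      refine ⟨i, hi, ?_⟩
      -- Looking beyond the length of `e (s ++ [i])` shows that `y` runs through that whole node;
      -- injectivity of `c s` makes the new direction agree with `i`.
      obtain ⟨j, -, hyj, s', -, hjs', h⟩ := ext s hs (max ((e s).length + 1)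
        (e (s ++ [i])).length) (lt_max_of_lt_left (Nat.lt_succ_self _))
      obtain rfl : i = j := (he s).1 (hyi.symm.trans hyj)
      have h1 := (restrict_prefix y (le_max_right _ _)).trans h
      exact (List.prefix_of_prefix_length_le h1 (he.mono hjs') (by simp)).eq_of_length
        (by simp))
  simp only [List.length_nil, Nat.zero_le, forall_const] at hx
  have hxt : restrict x t.length = t := by
    rcases (hx t.length).1.1 with h | h
    · exact h.eq_of_length (by simp)
    · exact (h.eq_of_length (by simp)).symm
  refine ⟨x, ⟨hxt, fun n hn => ?_⟩, ?_⟩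
  · exact (hx (n + 1)).1.2 _ _ (prefix_restrict hxt hn) (by rw [restrict_succ])
  · funext n
    have h := (hφ x (n + 1)).trans (hx (n + 1)).2.symm
    refine restrict_eq_iff.1 h n (n.lt_succ_self.trans_le
      ((length_restrict x (n + 1)).ge.trans (he.length_le (restrict x (n + 1)))))

theorem IsExpansion.map_mem_branches
    (he : IsExpansion c e)
    (hφ : ∀ x n, restrict (φ x) (e (restrict x n)).length = e (restrict x n))
    {T : Descriptive.tree ℕ} (hT : ∀ s, e s ∈ T) (x : ℕ → ℕ) : φ x ∈ branches T := by
  intro n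
  refine mem_of_prefix (restrict_prefix (φ x) ?_) (hφ x n ▸ hT (restrict x n))
  simpa using he.length_le (restrict x n)

end IsExpansion

/-- The construction of expansions by recursion. -/
theorem exists_expansion {G : Set (List ℕ)} {Q : List ℕ → List ℕ → Prop} {u₀ : List ℕ}
    (hu₀ : u₀ ∈ G)
    (h : ∀ u ∈ G, ∃ f : ℕ → ℕ, Function.Injective f ∧ ∀ i, ∃ v ∈ G, Q (u ++ [f i]) v) :
    ∃ (c : List ℕ → ℕ → ℕ) (e : List ℕ → List ℕ), e [] = u₀ ∧ (∀ s, e s ∈ G) ∧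
      ∀ s, Function.Injective (c s) ∧ ∀ i, Q (e s ++ [c s i]) (e (s ++ [i])) := by
  choose! f hf v hvG hv using h
  let e : List ℕ → List ℕ := fun s => s.foldl v u₀
  have he : ∀ s i, e (s ++ [i]) = v (e s) i := fun s i => by simp [e]
  have heG : ∀ s, e s ∈ G := fun s => by
    induction s using List.reverseRecOn with
    | nil => exact hu₀
    | append_singleton s i ih => rw [he]; exact hvG _ ih i
  exact ⟨fun s => f (e s), e, rfl, heG, fun s => ⟨hf _ (heG s), fun i => he s i ▸ hv _ (heG s) i⟩⟩

/-! ### Shifting sequences to those with prescribed parities -/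

/-- The finite sequence `2 s i + a i`. -/
def shiftList (a : ℕ → Bool) (s : List ℕ) : List ℕ := s.mapIdx fun i k => 2 * k + (a i).toNat

/-- The infinite sequence `2 x i + a i`. -/
def shift (a : ℕ → Bool) (x : ℕ → ℕ) : ℕ → ℕ := fun i => 2 * x i + (a i).toNat

/-- The parities of the entries of `x`. -/
def parity (x : ℕ → ℕ) : ℕ → Bool := fun n => decide (x n % 2 = 1)

theorem parity_shift (a : ℕ → Bool) (x : ℕ → ℕ) : parity (shift a x) = a := by
  funext n
  cases h : a n <;> simp [parity, shift, h]

@[simp] theorem length_shiftList (a : ℕ → Bool) (s : List ℕ) :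
    (shiftList a s).length = s.length := by simp [shiftList]

theorem shiftList_concat (a : ℕ → Bool) (s : List ℕ) (k : ℕ) :
    shiftList a (s ++ [k]) = shiftList a s ++ [2 * k + (a s.length).toNat] := by
  simp [shiftList, List.mapIdx_concat]

theorem restrict_shift (a : ℕ → Bool) (x : ℕ → ℕ) (n : ℕ) :
    restrict (shift a x) n = shiftList a (restrict x n) := by
  induction n with
  | zero => rfl
  | succ n ih => simp [restrict_succ, shiftList_concat, ih, shift]

theorem shiftList_injective (a : ℕ → Bool) : Function.Injective (shiftList a) := fun s s' h => by
  refine List.ext_getElem (by simpa using congrArg List.length h) fun i h1 h2 => ?_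
  have := List.getElem_of_eq h (i := i) (by simpa using h1)
  simp only [shiftList, List.getElem_mapIdx] at this
  omega

theorem shiftList_prefix {a : ℕ → Bool} {s s' : List ℕ} (h : s <+: s') :
    shiftList a s <+: shiftList a s' := by
  obtain ⟨r, rfl⟩ := h
  simp [shiftList, List.mapIdx_append]

theorem exists_of_prefix_shiftList {a : ℕ → Bool} {s u : List ℕ} (h : u <+: shiftList a s) :
    ∃ r, r <+: s ∧ u = shiftList a r := by
  refine ⟨s.take u.length, List.take_prefix _ _, ?_⟩
  refine (List.prefix_of_prefix_length_le h (shiftList_prefix (List.take_prefix _ _))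
    ?_).eq_of_length ?_ <;>
  · have := h.length_le
    simp at this ⊢
    omega

theorem prefix_of_shiftList_prefix {a : ℕ → Bool} {s s' : List ℕ}
    (h : shiftList a s <+: shiftList a s') : s <+: s' := by
  obtain ⟨r, hr, h⟩ := exists_of_prefix_shiftList h
  rwa [shiftList_injective a h]

/-- The image of a tree under the shift. -/
def shiftTree (a : ℕ → Bool) (T : Descriptive.tree ℕ) : Descriptive.tree ℕ :=
  ⟨shiftList a '' T, fun u k ⟨s, hs, h⟩ => by
    obtain ⟨r, hr, h⟩ := exists_of_prefix_shiftList (h ▸ List.prefix_append u [k])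
    exact ⟨r, mem_of_prefix hr hs, h.symm⟩⟩

/-- The preimage of a tree under the shift. -/
def unshiftTree (a : ℕ → Bool) (T : Descriptive.tree ℕ) : Descriptive.tree ℕ :=
  ⟨shiftList a ⁻¹' T, fun s k h =>
    mem_of_prefix (T := T) (shiftList_prefix (List.prefix_append s [k])) h⟩

theorem shiftList_mem_shiftTree {a : ℕ → Bool} {T : Descriptive.tree ℕ} {s : List ℕ} :
    shiftList a s ∈ shiftTree a T ↔ s ∈ T := (shiftList_injective a).mem_set_image

theorem succs_shiftTree (a : ℕ → Bool) (T : Descriptive.tree ℕ) (s : List ℕ) :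
    (fun k => 2 * k + (a s.length).toNat) '' succs T s ⊆ succs (shiftTree a T) (shiftList a s) := by
  rintro _ ⟨k, hk, rfl⟩
  exact ⟨s ++ [k], hk, shiftList_concat a s k⟩

theorem infinite_succs_shiftTree {a : ℕ → Bool} {T : Descriptive.tree ℕ} {s : List ℕ}
    (h : (succs T s).Infinite) : (succs (shiftTree a T) (shiftList a s)).Infinite :=
  (h.image fun k _ k' _ hk => by simpa using hk).mono (succs_shiftTree a T s)

/-- Because `T` lies in the range of the shift, every successor in `T` has the prescribed parity, so
none is lost by unshifting. -/
theorem infinite_succs_unshiftTree {a : ℕ → Bool} {T : Descriptive.tree ℕ} {s : List ℕ}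
    (hT : ∀ u ∈ T, u ∈ Set.range (shiftList a)) (h : (succs T (shiftList a s)).Infinite) :
    (succs (unshiftTree a T) s).Infinite := by
  have hsub : succs T (shiftList a s) ⊆
      (fun k => 2 * k + (a s.length).toNat) '' succs (unshiftTree a T) s := fun n hn => by
    obtain ⟨r, hr⟩ := hT _ hn
    obtain ⟨s', -, hs'⟩ := exists_of_prefix_shiftList (hr ▸ List.prefix_append (shiftList a s) [n])
    obtain rfl := shiftList_injective a hs'
    have hsr : s <+: r := prefix_of_shiftList_prefix (hr ▸ List.prefix_append (shiftList a s) [n])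
    obtain ⟨k, hk⟩ := exists_append_prefix hsr fun h => by
      have := congrArg List.length hr
      simp [h] at this
    have hk' : r = s ++ [k] := (hk.eq_of_length (by
      have := congrArg List.length hr
      simp at this ⊢
      omega)).symm
    subst hk'
    rw [shiftList_concat] at hr
    refine ⟨k, ?_, by simpa using hr⟩
    change shiftList a (s ++ [k]) ∈ T
    rw [shiftList_concat, hr]
    exact hn
  exact (h.mono hsub).of_image _

/-! ### The part of a tree that is comparable with a node -/

/-- The nodes of `T` that are comparable with `t`. -/
def through (T : Descriptive.tree ℕ) (t : List ℕ) : Descriptive.tree ℕ :=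
  ⟨{u | u ∈ T ∧ (u <+: t ∨ t <+: u)}, fun u k ⟨hu, h⟩ =>
    ⟨mem_of_prefix (List.prefix_append _ _) hu, by
      rcases h with h | h
      · exact Or.inl ((List.prefix_append _ _).trans h)
      · exact List.prefix_or_prefix_of_prefix (List.prefix_append _ _) h⟩⟩

theorem through_le (T : Descriptive.tree ℕ) (t : List ℕ) : through T t ≤ T := fun _ h => h.1

theorem restrict_eq_of_mem_branches_through {T : Descriptive.tree ℕ} {t : List ℕ} {x : ℕ → ℕ}
    (hx : x ∈ branches (through T t)) : restrict x t.length = t := by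
  rcases (hx t.length).2 with h | h
  · exact h.eq_of_length (by simp)
  · exact (h.eq_of_length (by simp)).symm

theorem succs_through {T : Descriptive.tree ℕ} {t u : List ℕ} (h : t <+: u) :
    succs (through T t) u = succs T u :=
  Set.ext fun _ => ⟨fun h' => h'.1, fun h' => ⟨h', Or.inr (h.trans (List.prefix_append _ _))⟩⟩

/-! ### The common properties of Laver and Miller forcing -/

/-- The properties of Laver forcing and Miller forcing on which the results on their tree ideals
rely. -/
structure IsLaverLike (𝕋 : Set (Descriptive.tree ℕ)) : Prop where
  nonempty : 𝕋.Nonempty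
  exists_expansion : ∀ T ∈ 𝕋, ∃ c e, IsExpansion c e ∧ (∀ s, e s ∈ T) ∧
    ∀ t K, (∀ s, (K s).Infinite) → imageTree e t K ∈ 𝕋
  through_mem : ∀ T ∈ 𝕋, ∀ t ∈ T, through T t ∈ 𝕋
  shiftTree_mem : ∀ a, ∀ T ∈ 𝕋, shiftTree a T ∈ 𝕋
  unshiftTree_mem : ∀ a, ∀ T ∈ 𝕋, (∀ u ∈ T, u ∈ Set.range (shiftList a)) → unshiftTree a T ∈ 𝕋

/-- Maximality of the stem is automatic: a strictly longer trunk node would allow only one successor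
at `s`. -/
theorem mem_laverForcing_iff {T : Descriptive.tree ℕ} :
    T ∈ laverForcing ↔ ∃ s, IsTrunkNode T s ∧ ∀ t ∈ T, s <+: t → (succs T t).Infinite := by
  refine ⟨fun ⟨s, hs, h⟩ => ⟨s, hs.1, h⟩, fun ⟨s, hs, h⟩ => ⟨s, ⟨hs, fun r hr => ?_⟩, h⟩⟩
  rcases hr.2 s hs.1 with hsr | hrs
  · by_contra hrs
    obtain ⟨i, hi⟩ := exists_append_prefix hsr fun h => hrs (h ▸ List.prefix_rfl)
    obtain ⟨j, hj, hij⟩ := ((h s hs.1 List.prefix_rfl).sdiff (Set.finite_singleton i)).nonempty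
    refine hij ?_
    rcases hr.2 _ hj with h' | h'
    · exact eq_of_append_prefix h' hi
    · exact eq_of_append_prefix List.prefix_rfl (hi.trans h')
  · exact hrs

theorem infinite_succs_imageTree {c : List ℕ → ℕ → ℕ} {e : List ℕ → List ℕ} (he : IsExpansion c e)
    {t s : List ℕ} {K : List ℕ → Set ℕ} (hK : (K s).Infinite) (hs : s ∈ nodesFrom t K)
    (hts : t <+: s) : (succs (imageTree e t K) (e s)).Infinite := by
  refine (hK.image (he s).1.injOn).mono ?_
  rintro _ ⟨k, hk, rfl⟩
  exact ⟨s ++ [k], append_mem_nodesFrom hs hts hk, (he s).2 k⟩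

/-- Above the stem every node splits, so the expansion can add exactly one entry per step. Hence
each node of the image tree above `e t` is a value of `e` and splits infinitely. -/
theorem isLaverLike_laverForcing : IsLaverLike laverForcing where
  nonempty := ⟨⟨Set.univ, fun _ _ _ => trivial⟩, mem_laverForcing_iff.2
    ⟨[], ⟨trivial, fun _ _ => Or.inr List.nil_prefix⟩, fun _ _ _ => Set.infinite_univ⟩⟩
  exists_expansion := by
    intro T hT
    obtain ⟨s₀, hs₀, hinf⟩ := mem_laverForcing_iff.1 hT
    obtain ⟨c, e, he0, heG, hce⟩ := exists_expansion (G := {u | u ∈ T ∧ s₀ <+: u})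
      (Q := fun u v => v = u) (u₀ := s₀) ⟨hs₀.1, List.prefix_rfl⟩ fun u hu =>
        ⟨fun i => (hinf u hu.1 hu.2).natEmbedding _ i,
          Subtype.val_injective.comp ((hinf u hu.1 hu.2).natEmbedding _).injective, fun i =>
          ⟨_, ⟨((hinf u hu.1 hu.2).natEmbedding _ i).2, hu.2.trans (List.prefix_append _ _)⟩, rfl⟩⟩
    have he : IsExpansion c e := fun s => ⟨(hce s).1, fun i => by
      rw [(hce s).2 i]⟩
    refine ⟨c, e, he, fun s => (heG s).1, fun t K hK => mem_laverForcing_iff.2 ⟨e t,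
      ⟨⟨t, self_mem_nodesFrom, List.prefix_rfl⟩, ?_⟩, ?_⟩⟩
    · rintro u ⟨s, hs, hu⟩
      rcases hs.1 with h | h
      · exact Or.inl (hu.trans (he.mono h))
      · exact List.prefix_or_prefix_of_prefix hu (he.mono h)
    · rintro u ⟨s, hs, hu⟩ htu
      have key : ∃ s', s' <+: s ∧ u = e s' := by
        clear hs
        induction s using List.reverseRecOn with
        | nil =>
          refine ⟨[], List.prefix_rfl, ?_⟩
          exact hu.eq_of_length_le ((he.mono List.nil_prefix).trans htu).length_le
        | append_singleton r i ih =>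
          rw [(hce r).2 i] at hu
          rcases List.prefix_concat_iff.1 hu with h | h
          · exact ⟨_, List.prefix_rfl, by rw [(hce r).2 i, h]⟩
          · obtain ⟨s', hs', h⟩ := ih h
            exact ⟨s', hs'.trans (List.prefix_append _ _), h⟩
      obtain ⟨s', hs', rfl⟩ := key
      exact infinite_succs_imageTree he (hK s') (mem_nodesFrom_of_prefix hs' hs)
        (he.prefix_of_prefix htu)
  through_mem := by
    intro T hT t ht
    obtain ⟨s, hs, hinf⟩ := mem_laverForcing_iff.1 hT
    refine mem_laverForcing_iff.2 ?_
    rcases hs.2 t ht with h | h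
    · refine ⟨s, ⟨⟨hs.1, Or.inr h⟩, fun u hu => hs.2 u hu.1⟩, fun u hu hsu => ?_⟩
      rw [succs_through (h.trans hsu)]
      exact hinf u hu.1 hsu
    · refine ⟨t, ⟨⟨ht, Or.inr List.prefix_rfl⟩, fun u hu => hu.2⟩, fun u hu htu => ?_⟩
      rw [succs_through htu]
      exact hinf u hu.1 (h.trans htu)
  shiftTree_mem := by
    intro a T hT
    obtain ⟨s, hs, hinf⟩ := mem_laverForcing_iff.1 hT
    refine mem_laverForcing_iff.2 ⟨shiftList a s, ⟨shiftList_mem_shiftTree.2 hs.1, ?_⟩, ?_⟩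
    · rintro _ ⟨t, ht, rfl⟩
      exact (hs.2 t ht).imp shiftList_prefix shiftList_prefix
    · rintro _ ⟨t, ht, rfl⟩ h
      exact infinite_succs_shiftTree (hinf t ht (prefix_of_shiftList_prefix h))
  unshiftTree_mem := by
    intro a T hT hrange
    obtain ⟨u, hu, hinf⟩ := mem_laverForcing_iff.1 hT
    obtain ⟨s, rfl⟩ := hrange u hu.1
    refine mem_laverForcing_iff.2 ⟨s, ⟨hu.1, fun t ht => ?_⟩, fun t ht hst => ?_⟩
    · exact (hu.2 _ ht).imp prefix_of_shiftList_prefix prefix_of_shiftList_prefix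
    · exact infinite_succs_unshiftTree hrange (hinf _ ht (shiftList_prefix hst))

/-- Here the expansion jumps from one infinitely splitting node to another, which is why
`IsExpansion` asks only for a prefix. -/
theorem isLaverLike_millerForcing : IsLaverLike millerForcing where
  nonempty := ⟨⟨Set.univ, fun _ _ _ => trivial⟩, ⟨[], trivial⟩, fun t _ =>
    ⟨t, trivial, List.prefix_rfl, Set.infinite_univ⟩⟩
  exists_expansion := by
    rintro T ⟨⟨t₀, ht₀⟩, hT⟩
    obtain ⟨s₀, hs₀, -, hs₀'⟩ := hT t₀ ht₀
    obtain ⟨c, e, -, heG, he⟩ := exists_expansion (G := {u | u ∈ T ∧ (succs T u).Infinite})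
      (Q := fun u v => u <+: v) (u₀ := s₀) ⟨hs₀, hs₀'⟩ fun u hu =>
        ⟨fun i => hu.2.natEmbedding _ i,
          Subtype.val_injective.comp (hu.2.natEmbedding _).injective, fun i => by
          obtain ⟨v, hv, huv, hv'⟩ := hT _ (hu.2.natEmbedding _ i).2
          exact ⟨v, ⟨hv, hv'⟩, huv⟩⟩
    refine ⟨c, e, he, fun s => (heG s).1, fun t K hK => ⟨⟨[], t, self_mem_nodesFrom,
      List.nil_prefix⟩, ?_⟩⟩
    rintro u ⟨s, hs, hu⟩
    obtain ⟨s', hs', hts', hss'⟩ := exists_mem_nodesFrom_of_mem hs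
    exact ⟨e s', ⟨s', hs', List.prefix_rfl⟩, hu.trans (IsExpansion.mono he hss'),
      infinite_succs_imageTree he (hK s') hs' hts'⟩
  through_mem := by
    rintro T ⟨-, hT⟩ t ht
    refine ⟨⟨t, ht, Or.inl List.prefix_rfl⟩, fun u hu => ?_⟩
    obtain ⟨v, hv, htv, huv⟩ : ∃ v ∈ T, t <+: v ∧ u <+: v := by
      rcases hu.2 with h | h
      · exact ⟨t, ht, List.prefix_rfl, h⟩
      · exact ⟨u, hu.1, h, List.prefix_rfl⟩
    obtain ⟨s, hs, hvs, hinf⟩ := hT v hv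
    refine ⟨s, ⟨hs, Or.inr (htv.trans hvs)⟩, huv.trans hvs, ?_⟩
    rwa [succs_through (htv.trans hvs)]
  shiftTree_mem := by
    rintro a T ⟨⟨t₀, ht₀⟩, hT⟩
    refine ⟨⟨_, shiftList_mem_shiftTree.2 ht₀⟩, ?_⟩
    rintro _ ⟨t, ht, rfl⟩
    obtain ⟨s, hs, hts, hinf⟩ := hT t ht
    exact ⟨_, shiftList_mem_shiftTree.2 hs, shiftList_prefix hts, infinite_succs_shiftTree hinf⟩
  unshiftTree_mem := by
    rintro a T ⟨⟨t₀, ht₀⟩, hT⟩ hrange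
    refine ⟨⟨[], mem_of_prefix (T := T) List.nil_prefix ht₀⟩, fun t ht => ?_⟩
    obtain ⟨u, hu, htu, hinf⟩ := hT _ ht
    obtain ⟨s, rfl⟩ := hrange u hu
    exact ⟨s, hu, prefix_of_shiftList_prefix htu, infinite_succs_unshiftTree hrange hinf⟩

/-! ### Members of the tree ideals -/

theorem mem_treeIdeal {𝕋 : Set (Descriptive.tree ℕ)} {X : Set (ℕ → ℕ)} :
    X ∈ treeIdeal 𝕋 ↔ ∀ T ∈ 𝕋, ∃ S ∈ 𝕋, S ≤ T ∧ X ∩ branches S = ∅ := Iff.rfl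

theorem branches_mono {S T : Descriptive.tree ℕ} (h : S ≤ T) : branches S ⊆ branches T :=
  fun _ hx n => h (hx n)

theorem mk_Iic_toType_ord_lt {κ : Cardinal.{0}} (hκ : ℵ₀ ≤ κ) (i : κ.ord.ToType) :
    #(Set.Iic i) < κ := by
  rw [← Set.Iio_insert]
  refine (Cardinal.mk_insert_le).trans_lt (Cardinal.add_lt_of_lt hκ ?_
    (Cardinal.one_lt_aleph0.trans_le hκ))
  simpa using Cardinal.mk_Iio_lt i (by simp)

theorem mk_bool_seq : #(ℕ → Bool) = 𝔠 := by simp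

theorem imageTree_le {e : List ℕ → List ℕ} {T : Descriptive.tree ℕ} (h : ∀ s, e s ∈ T)
    (t : List ℕ) (K : List ℕ → Set ℕ) : imageTree e t K ≤ T := fun _ ⟨s, _, hu⟩ =>
  mem_of_prefix hu (h s)

variable {𝕋 : Set (Descriptive.tree ℕ)}

instance : Nonempty (treeIdeal 𝕋) := (treeIdeal 𝕋).nonempty.to_subtype

theorem IsLaverLike.exists_mem_branches (h𝕋 : IsLaverLike 𝕋) {T : Descriptive.tree ℕ}
    (hT : T ∈ 𝕋) : ∃ x, x ∈ branches T := by
  obtain ⟨c, e, he, heT, -⟩ := h𝕋.exists_expansion T hT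
  obtain ⟨φ, hφ⟩ := he.exists_map
  exact ⟨_, he.map_mem_branches hφ heT 0⟩

theorem IsLaverLike.univ_notMem (h𝕋 : IsLaverLike 𝕋) : Set.univ ∉ treeIdeal 𝕋 := fun h => by
  obtain ⟨T, hT⟩ := h𝕋.nonempty
  obtain ⟨S, hS, -, hSe⟩ := mem_treeIdeal.1 h T hT
  obtain ⟨x, hx⟩ := h𝕋.exists_mem_branches hS
  exact hSe.subset ⟨trivial, hx⟩

/-- Sets of size less than the continuum belong to the tree ideal. -/
theorem IsLaverLike.mem_of_mk_lt (h𝕋 : IsLaverLike 𝕋) {X : Set (ℕ → ℕ)} (hX : #X < 𝔠) :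
    X ∈ treeIdeal 𝕋 := by
  refine mem_treeIdeal.2 fun T hT => ?_
  obtain ⟨c, e, he, heT, heK⟩ := h𝕋.exists_expansion T hT
  obtain ⟨φ, hφ⟩ := he.exists_map
  -- Prescribing the parities of the preimages gives 𝔠 trees below `T` with pairwise disjoint branch
  -- sets; a smaller `X` must miss one of them.
  let K : (ℕ → Bool) → List ℕ → Set ℕ := fun a s => {k | decide (k % 2 = 1) = a s.length}
  have hK : ∀ a s, (K a s).Infinite := fun a s => by
    refine Set.infinite_of_injective_forall_mem (f := fun k => 2 * k + (a s.length).toNat)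
      (fun k k' hk => by simpa using hk) fun k => ?_
    cases h : a s.length <;> simp [K, h]
  have hpar : ∀ a, ∀ x ∈ branchesFrom [] (K a), parity x = a := fun a x hx => by
    funext n
    simpa [K, parity] using hx.2 n (Nat.zero_le n)
  by_contra! hcon
  have hmeet : ∀ a, ∃ x, x ∈ X ∧ x ∈ branches (imageTree e [] (K a)) := fun a =>
    hcon _ (heK [] (K a) (hK a)) (imageTree_le heT _ _)
  choose z hzX hz using hmeet
  have hinj : Function.Injective fun a => (⟨z a, hzX a⟩ : X) := fun a b hab => by
    have hab : z a = z b := congrArg Subtype.val hab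
    obtain ⟨x, hx, hxa⟩ := he.branches_imageTree_subset hφ (hz a)
    obtain ⟨x', hx', hxb⟩ := he.branches_imageTree_subset hφ (hz b)
    obtain rfl : x = x' := he.map_injective hφ (by rw [hxa, hxb, hab])
    rw [← hpar a x hx, hpar b x hx']
  have := Cardinal.mk_le_of_injective hinj
  rw [mk_bool_seq] at this
  exact this.not_gt hX

/-- The parity map is constant or injective on the branches of densely many trees. -/
theorem IsLaverLike.exists_parity_const_or_injOn (h𝕋 : IsLaverLike 𝕋) {T : Descriptive.tree ℕ}
    (hT : T ∈ 𝕋) : ∃ S ∈ 𝕋, S ≤ T ∧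
      ((∃ a, ∀ x ∈ branches S, parity x = a) ∨ Set.InjOn parity (branches S)) := by
  obtain ⟨c, e, he, heT, heK⟩ := h𝕋.exists_expansion T hT
  obtain ⟨φ, hφ⟩ := he.exists_map
  have hcont : IsCont fun x => parity (φ x) := fun x n => ⟨n + 1, fun x' h => by
    simp [parity, he.map_apply_congr hφ h]⟩
  obtain ⟨t, K, hK, h⟩ := hcont.exists_const_or_injOn
  refine ⟨_, heK t K hK, imageTree_le heT _ _, ?_⟩
  rcases h with ⟨a, ha⟩ | h
  · refine Or.inl ⟨a, fun y hy => ?_⟩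
    obtain ⟨x, hx, rfl⟩ := he.branches_imageTree_subset hφ hy
    exact ha x hx
  · refine Or.inr fun y hy y' hy' hyy' => ?_
    obtain ⟨x, hx, rfl⟩ := he.branches_imageTree_subset hφ hy
    obtain ⟨x', hx', rfl⟩ := he.branches_imageTree_subset hφ hy'
    rw [h hx hx' hyy']

theorem IsLaverLike.preimage_shift_mem (h𝕋 : IsLaverLike 𝕋) (a : ℕ → Bool) {Y : Set (ℕ → ℕ)}
    (hY : Y ∈ treeIdeal 𝕋) : shift a ⁻¹' Y ∈ treeIdeal 𝕋 := by
  refine mem_treeIdeal.2 fun T hT => ?_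
  obtain ⟨S, hS, hST, hYS⟩ := mem_treeIdeal.1 hY _ (h𝕋.shiftTree_mem a T hT)
  refine ⟨unshiftTree a S, h𝕋.unshiftTree_mem a S hS fun u hu => ?_, fun s hs => ?_, ?_⟩
  · obtain ⟨s, -, h⟩ := hST hu
    exact ⟨s, h⟩
  · exact shiftList_mem_shiftTree.1 (hST hs)
  · refine Set.eq_empty_of_forall_notMem fun x hx => hYS.subset ⟨hx.1, fun n => ?_⟩
    rw [restrict_shift]
    exact hx.2 n

theorem IsLaverLike.image_shift_mem (h𝕋 : IsLaverLike 𝕋) (a : ℕ → Bool) {X : Set (ℕ → ℕ)}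
    (hX : X ∈ treeIdeal 𝕋) : shift a '' X ∈ treeIdeal 𝕋 := by
  refine mem_treeIdeal.2 fun T hT => ?_
  -- A tree that leaves the range of the shift has a node through which no shifted sequence passes.
  by_cases hrange : ∀ u ∈ T, u ∈ Set.range (shiftList a)
  · obtain ⟨S, hS, hST, hXS⟩ := mem_treeIdeal.1 hX _ (h𝕋.unshiftTree_mem a T hT hrange)
    refine ⟨shiftTree a S, h𝕋.shiftTree_mem a S hS, ?_, ?_⟩
    · rintro _ ⟨s, hs, rfl⟩
      exact hST hs
    · refine Set.eq_empty_of_forall_notMem ?_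
      rintro _ ⟨⟨x, hx, rfl⟩, hxS⟩
      refine hXS.subset ⟨hx, fun n => ?_⟩
      have := hxS n
      rw [restrict_shift] at this
      exact shiftList_mem_shiftTree.1 this
  · push Not at hrange
    obtain ⟨u, hu, hur⟩ := hrange
    refine ⟨through T u, h𝕋.through_mem T hT u hu, through_le T u, ?_⟩
    refine Set.eq_empty_of_forall_notMem ?_
    rintro _ ⟨⟨x, -, rfl⟩, hx⟩
    exact hur ⟨restrict x u.length,
      (restrict_shift a x u.length).symm.trans (restrict_eq_of_mem_branches_through hx)⟩

/-! ### The diagonalization and the cofinality -/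

theorem IsLaverLike.one_lt_cof (h𝕋 : IsLaverLike 𝕋) : 1 < Order.cof (treeIdeal 𝕋) := by
  rw [Order.one_lt_cof_iff]
  refine ⟨fun Y => ?_⟩
  obtain ⟨x, hx⟩ := (Set.ne_univ_iff_exists_notMem (Y : Set (ℕ → ℕ))).1 fun h =>
    h𝕋.univ_notMem (h ▸ Y.2)
  have hmem : ({x} : Set (ℕ → ℕ)) ∈ treeIdeal 𝕋 := h𝕋.mem_of_mk_lt (by
    rw [Cardinal.mk_singleton]
    exact Cardinal.one_lt_aleph0.trans Cardinal.aleph0_lt_continuum)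
  exact ⟨⟨{x}, hmem⟩, fun h => hx (h rfl)⟩

/-- Suppose that `X` meets every fibre of the parity map in a set from the tree ideal, and that it
meets the branches of any tree on which the parity map is injective in a few fibres only. Then `X`
belongs to the tree ideal. -/
theorem IsLaverLike.mem_of_fibres (h𝕋 : IsLaverLike 𝕋) (f : (ℕ → Bool) ≃ Cardinal.continuum.{0}.ord.ToType)
    (j : Descriptive.tree ℕ → Cardinal.continuum.{0}.ord.ToType) {X : Set (ℕ → ℕ)}
    (hfib : ∀ a, {x ∈ X | parity x = a} ∈ treeIdeal 𝕋)
    (hX : ∀ x ∈ X, ∀ S, Set.InjOn parity (branches S) → x ∈ branches S → f (parity x) ≤ j S) :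
    X ∈ treeIdeal 𝕋 := by
  refine mem_treeIdeal.2 fun T hT => ?_
  obtain ⟨S, hS, hST, ⟨a, ha⟩ | hinj⟩ := h𝕋.exists_parity_const_or_injOn hT
  · obtain ⟨R, hR, hRS, he⟩ := mem_treeIdeal.1 (hfib a) S hS
    refine ⟨R, hR, hRS.trans hST, Set.eq_empty_of_forall_notMem fun x hx => ?_⟩
    exact he.subset ⟨⟨hx.1, ha x (branches_mono hRS hx.2)⟩, hx.2⟩
  · have hsmall : X ∩ branches S ∈ treeIdeal 𝕋 := by
      refine h𝕋.mem_of_mk_lt (lt_of_le_of_lt ?_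
        (mk_Iic_toType_ord_lt Cardinal.aleph0_le_continuum (j S)))
      refine Cardinal.mk_le_of_injective
        (f := fun x => ⟨f (parity x.1), hX x.1 x.2.1 S hinj x.2.2⟩) fun x x' h => ?_
      exact Subtype.ext (hinj x.2.2 x'.2.2 (f.injective (congrArg Subtype.val h)))
    obtain ⟨R, hR, hRS, he⟩ := mem_treeIdeal.1 hsmall S hS
    refine ⟨R, hR, hRS.trans hST, Set.eq_empty_of_forall_notMem fun x hx => ?_⟩
    exact he.subset ⟨⟨hx.1, branches_mono hRS hx.2⟩, hx.2⟩

theorem IsLaverLike.not_isCofinal_iUnion (h𝕋 : IsLaverLike 𝕋)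
    (J : (ℕ → Bool) → Set (treeIdeal 𝕋)) (hJ : ∀ a, #(J a) < Order.cof (treeIdeal 𝕋)) :
    ¬ IsCofinal (⋃ a, J a) := by
  obtain ⟨f⟩ : Nonempty ((ℕ → Bool) ≃ Cardinal.continuum.{0}.ord.ToType) := Cardinal.eq.1 (by simp)
  obtain ⟨j⟩ : Nonempty (Descriptive.tree ℕ ↪ Cardinal.continuum.{0}.ord.ToType) := by
    rw [← Cardinal.le_def, Cardinal.mk_ord_toType]
    refine (Cardinal.mk_subtype_le _).trans ?_
    simp
  -- The points of fibre `a` on trees of index below `f a`: each such tree contributes at most one,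
  -- so there are fewer than 𝔠. Outside `B a`, a tree with injective parity meets fibre `a` only if
  -- `f a ≤ j S`.
  let B : (ℕ → Bool) → Set (ℕ → ℕ) := fun a => {x | parity x = a ∧
    ∃ S, Set.InjOn parity (branches S) ∧ j S < f a ∧ x ∈ branches S}
  have hB : ∀ a, B a ∈ treeIdeal 𝕋 := fun a => by
    refine h𝕋.mem_of_mk_lt (lt_of_le_of_lt ?_
      (mk_Iic_toType_ord_lt Cardinal.aleph0_le_continuum (f a)))
    choose S hSinj hSj hxS using fun x : B a => x.2.2
    refine Cardinal.mk_le_of_injective (f := fun x => ⟨j (S x), (hSj x).le⟩) fun x x' h => ?_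
    have hSS : S x = S x' := j.injective (congrArg Subtype.val h)
    exact Subtype.ext (hSinj x (hxS x) (hSS ▸ hxS x') (x.2.1.trans x'.2.1.symm))
  have hex : ∀ a, ∃ X ∈ treeIdeal 𝕋, ∀ Y ∈ J a, ¬ X ⊆ shift a ⁻¹' (Y ∪ B a) := fun a => by
    let F : treeIdeal 𝕋 → treeIdeal 𝕋 := fun Y => ⟨shift a ⁻¹' (Y ∪ B a),
      h𝕋.preimage_shift_mem a (Order.Ideal.sup_mem Y.2 (hB a))⟩
    -- Pulling back along the shift does not increase the size of `J a`, so the pullbacks are too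
    -- few to be cofinal.
    have hnot : ¬ IsCofinal (F '' J a) := fun h =>
      ((Order.cof_le h).trans Cardinal.mk_image_le).not_gt (hJ a)
    simp only [IsCofinal, not_forall, not_exists, not_and] at hnot
    obtain ⟨X, hX⟩ := hnot
    exact ⟨X, X.2, fun Y hY h => hX (F Y) ⟨Y, hY, rfl⟩ h⟩
  choose X hXI hXJ using hex
  have hU : (⋃ a, shift a '' X a \ B a) ∈ treeIdeal 𝕋 := by
    have hmem : ∀ x ∈ ⋃ a, shift a '' X a \ B a,
        x ∈ shift (parity x) '' X (parity x) \ B (parity x) := fun x hx => by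
      obtain ⟨a, hx⟩ := Set.mem_iUnion.1 hx
      obtain ⟨z, -, hz⟩ := hx.1
      have ha : parity x = a := by rw [← hz, parity_shift]
      rwa [ha]
    refine h𝕋.mem_of_fibres f j (fun a => ?_) fun x hx S hS hxS => ?_
    · refine (treeIdeal 𝕋).lower ?_ (h𝕋.image_shift_mem a (hXI a))
      rintro x ⟨hx, rfl⟩
      exact (hmem x hx).1
    · by_contra! hlt
      exact (hmem x hx).2 ⟨rfl, S, hS, hlt, hxS⟩
  intro hcof
  obtain ⟨Y, hY, hUY⟩ := hcof ⟨_, hU⟩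
  obtain ⟨a, hYa⟩ := Set.mem_iUnion.1 hY
  refine hXJ a Y hYa fun x hx => ?_
  by_cases hxB : shift a x ∈ B a
  · exact Or.inr hxB
  · exact Or.inl (hUY (Set.mem_iUnion.2 ⟨a, ⟨x, hx, rfl⟩, hxB⟩))

theorem exists_surjective_of_mk_le_continuum {α : Type} [Nonempty α] (h : #α ≤ 𝔠) :
    ∃ f : (ℕ → Bool) → α, Function.Surjective f := by
  rw [← mk_bool_seq, Cardinal.le_def] at h
  obtain ⟨f⟩ := h
  exact ⟨_, Function.invFun_surjective f.injective⟩

theorem IsLaverLike.continuum_lt_cof (h𝕋 : IsLaverLike 𝕋) : 𝔠 < Order.cof (treeIdeal 𝕋) := by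
  by_contra! hle
  obtain ⟨s, hs, hcard⟩ := Order.exists_cof_eq (treeIdeal 𝕋)
  have := hs.nonempty.to_subtype
  obtain ⟨f, hf⟩ := exists_surjective_of_mk_le_continuum (α := s) (hcard.trans_le hle)
  refine h𝕋.not_isCofinal_iUnion (fun a => {(f a).1}) (fun a => ?_) (hs.mono fun Y hY => ?_)
  · rw [Cardinal.mk_singleton]
    exact h𝕋.one_lt_cof
  · obtain ⟨a, ha⟩ := hf ⟨Y, hY⟩
    exact Set.mem_iUnion.2 ⟨a, by simp [ha]⟩

theorem IsLaverLike.continuum_lt_cof_ord_cof (h𝕋 : IsLaverLike 𝕋) :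
    𝔠 < (Order.cof (treeIdeal 𝕋)).ord.cof := by
  by_contra! hle
  set κ := Order.cof (treeIdeal 𝕋) with hκ
  have hκ₀ : ℵ₀ ≤ κ := Cardinal.aleph0_le_continuum.trans h𝕋.continuum_lt_cof.le
  obtain ⟨s, hs, hcard⟩ := Order.exists_cof_eq (treeIdeal 𝕋)
  obtain ⟨g⟩ : Nonempty (s ≃ κ.ord.ToType) := Cardinal.eq.1 (by
    rw [hcard, Cardinal.mk_ord_toType])
  obtain ⟨C, hC, hCcard⟩ := Order.exists_cof_eq κ.ord.ToType
  have := hs.nonempty.to_subtype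
  have : Nonempty κ.ord.ToType := g.symm.nonempty
  have := hC.nonempty.to_subtype
  obtain ⟨f, hf⟩ := exists_surjective_of_mk_le_continuum (α := C)
    (hCcard.trans_le (by rwa [Ordinal.cof_toType]))
  -- The cofinal family, enumerated in order type `κ.ord`, is cut into initial segments of size less
  -- than `κ`, ending at the points of the cofinal set `C`, which has at most 𝔠 elements.
  refine h𝕋.not_isCofinal_iUnion (fun a => Subtype.val '' (g ⁻¹' Set.Iic (f a).1)) (fun a => ?_)
    (hs.mono fun Y hY => ?_)
  · refine (Cardinal.mk_image_le.trans ?_).trans_lt (mk_Iic_toType_ord_lt hκ₀ (f a).1)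
    exact Cardinal.mk_preimage_of_injective _ _ g.injective
  · obtain ⟨i, hi, hgi⟩ := hC (g ⟨Y, hY⟩)
    obtain ⟨a, ha⟩ := hf ⟨i, hi⟩
    exact Set.mem_iUnion.2 ⟨a, ⟨Y, hY⟩, by simpa [ha] using hgi, rfl⟩

end TreeForcing

/-- The cofinality of a cardinal `κ` is `κ.ord.cof`. -/
theorem mainTheorem1 :
    (Cardinal.continuum.{0} < (TreeForcing.idealCof TreeForcing.laverIdeal).ord.cof ∧
      Cardinal.continuum.{0} < (TreeForcing.idealCof TreeForcing.millerIdeal).ord.cof) ∧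
    (Cardinal.continuum.{0} < TreeForcing.idealCof TreeForcing.laverIdeal ∧
      Cardinal.continuum.{0} < TreeForcing.idealCof TreeForcing.millerIdeal) :=
  ⟨⟨TreeForcing.isLaverLike_laverForcing.continuum_lt_cof_ord_cof,
    TreeForcing.isLaverLike_millerForcing.continuum_lt_cof_ord_cof⟩,
    TreeForcing.isLaverLike_laverForcing.continuum_lt_cof,
    TreeForcing.isLaverLike_millerForcing.continuum_lt_cof⟩
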